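/- Let $G$ be a compact Lie group with Lie algebra $\mathfrak g$ (identified with $T_eG$ and with the left-invariant vector fields on $G$). Let $J\subseteq\mathbb R$ be a non-degenerate interval containing $0$, and let $(h_t)_{t\in J}$ be a path of left-invariant Riemannian metrics on $G$ such that $h_0$ is bi-invariant and $t\mapsto h_t(A,B)$ is of class $C^2$ at $t=0$ for all $A,B\in\mathfrak g$ (for instance, a smooth path). All derivatives in $t$ are taken within $J$ (hence one-sided if $0$ is an endpoint of $J$). Write $\langle A,B\rangle=h_0(A,B)$ and $|A|^2=h_0(A,A)$ for $A,B\in\mathfrak g$. Let $\Phi_t:\mathfrak g\to\mathfrak g$ be the endomorphism with $h_t(A,B)=\langle\Phi_tA,B\rangle$ for all $A,B\in\mathfrak g$, and let $\Psi=\frac{d}{dt}\big|_{t=0}\Phi_t$. Let $X,Y\in\mathfrak g$ with $[X,Y]=0$, and let $k(t)=h_t(R^t(X,Y)Y,X)$ be the unnormalized sectional curvature of $X$ and $Y$ with respect to $h_t$, where $R^t(X,Y)Z=\nabla^t_X\nabla^t_YZ-\nabla^t_Y\nabla^t_XZ-\nabla^t_{[X,Y]}Z$ is the curvature tensor of the Levi-Civita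 connection $\nabla^t$ of $h_t$. Then $k$ is of class $C^2$ at $t=0$, $k(0)=0$, $k'(0)=0$, and $$2k''(0)=\big|[X,\Psi Y]+[\Psi X,Y]\big|^2=\Big|\frac{d}{dt}\Big|_{t=0}[\Phi_tX,\Phi_tY]\Big|^2 .$$ In particular $k''(0)\ge 0$. -/

import Mathlib

open scoped Manifold ContDiff

noncomputable section

section Riemannian

open Bundle VectorField FiberBundle

variable {E : Type*} [NormedAddCommGroup E] [NormedSpace ℝ E]
  {H : Type*} [TopologicalSpace H] {I : ModelWithCorners ℝ E H}
  {M : Type*} [TopologicalSpace M] [ChartedSpace H M] [IsManifold I ∞ M]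

variable (I M) in
/-- Smooth Riemannian metrics on the manifold `M`. -/
abbrev SmoothMetric : Type _ :=
  ContMDiffRiemannianMetric I ∞ E (fun x : M ↦ TangentSpace I x)

variable (I M) in
/-- Affine connections on the manifold `M`; `cov Y x (X x)` is the value of `∇_X Y` at `x`. -/
abbrev AffineConnection : Type _ :=
  CovariantDerivative I E (fun x : M ↦ TangentSpace I x)

/-- `cov` is a Levi-Civita connection of `g`: it is torsion free, `∇_X Y - ∇_Y X = [X, Y]`, and
compatible with the metric, `v (g(Y, Z)) = g(∇_v Y, Z) + g(Y, ∇_v Z)`. -/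
structure IsLeviCivita (g : SmoothMetric I M) (cov : AffineConnection I M) : Prop where
  torsion_free : ∀ {X Y : Π x : M, TangentSpace I x} {x : M},
    MDiffAt (T% X) x → MDiffAt (T% Y) x →
      cov Y x (X x) - cov X x (Y x) = mlieBracket I X Y x
  metric : ∀ {Y Z : Π x : M, TangentSpace I x} {x : M} (v : TangentSpace I x),
    MDiffAt (T% Y) x → MDiffAt (T% Z) x →
      d% (fun y ↦ g.inner y (Y y) (Z y)) x v
        = g.inner x (cov Y x v) (Z x) + g.inner x (Y x) (cov Z x v)

theorem SmoothMetric.mdifferentiableAt_inner (g : SmoothMetric I M)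
    {Y Z : Π x : M, TangentSpace I x} {x : M}
    (hY : MDiffAt (T% Y) x) (hZ : MDiffAt (T% Z) x) :
    MDiffAt (fun y ↦ g.inner y (Y y) (Z y)) x := by
  let _ : RiemannianBundle (fun x : M ↦ TangentSpace I x) := ⟨g.toRiemannianMetric⟩
  have : IsContMDiffRiemannianBundle I 1 E (fun x : M ↦ TangentSpace I x) :=
    IsContMDiffRiemannianBundle.of_le (n := ∞) (by norm_cast)
  exact MDifferentiableAt.inner_bundle (E := fun x : M ↦ TangentSpace I x) hY hZ

theorem SmoothMetric.ext_inner (g : SmoothMetric I M) {x : M} {u v : TangentSpace I x}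
    (h : ∀ w, g.inner x u w = g.inner x v w) : u = v := by
  by_contra hne
  have h1 := g.pos x (u - v) (sub_ne_zero.2 hne)
  have h2 := h (u - v)
  simp only [map_sub, sub_apply] at h1 h2
  linarith

/-- The right-hand side of the Koszul formula for `2 g(∇_X Y, Z)` at the point `x`. -/
def koszul (g : SmoothMetric I M) (X Y Z : Π x : M, TangentSpace I x) (x : M) : ℝ :=
  d% (fun y ↦ g.inner y (Y y) (Z y)) x (X x) + d% (fun y ↦ g.inner y (X y) (Z y)) x (Y x)
    - d% (fun y ↦ g.inner y (X y) (Y y)) x (Z x)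
    + g.inner x (mlieBracket I X Y x) (Z x) - g.inner x (mlieBracket I X Z x) (Y x)
    - g.inner x (mlieBracket I Y Z x) (X x)

variable [FiniteDimensional ℝ E]

theorem tensorialAt_koszul_left (g : SmoothMetric I M) {Y Z : Π x : M, TangentSpace I x} {x : M}
    (hY : MDiffAt (T% Y) x) (hZ : MDiffAt (T% Z) x) :
    TensorialAt I E (fun X : Π x : M, TangentSpace I x ↦ koszul g X Y Z x) x := by
  have : CompleteSpace E := FiniteDimensional.complete ℝ E
  constructor
  · intro f X hf hX
    simp only [koszul, mlieBracket_smul_left hf hX]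
    simp [mvfderiv_fun_mul hf (g.mdifferentiableAt_inner hX hZ),
      mvfderiv_fun_mul hf (g.mdifferentiableAt_inner hX hY)]
    ring
  · intro X X' hX hX'
    simp only [koszul, mlieBracket_add_left hX hX']
    simp [mvfderiv_fun_add (g.mdifferentiableAt_inner hX hZ) (g.mdifferentiableAt_inner hX' hZ),
      mvfderiv_fun_add (g.mdifferentiableAt_inner hX hY) (g.mdifferentiableAt_inner hX' hY)]
    ring

theorem tensorialAt_koszul_right (g : SmoothMetric I M) {X Y : Π x : M, TangentSpace I x} {x : M}
    (hX : MDiffAt (T% X) x) (hY : MDiffAt (T% Y) x) :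
    TensorialAt I E (fun Z : Π x : M, TangentSpace I x ↦ koszul g X Y Z x) x := by
  have : CompleteSpace E := FiniteDimensional.complete ℝ E
  constructor
  · intro f Z hf hZ
    simp only [koszul, mlieBracket_smul_right hf hZ]
    simp [mvfderiv_fun_mul hf (g.mdifferentiableAt_inner hX hZ),
      mvfderiv_fun_mul hf (g.mdifferentiableAt_inner hY hZ)]
    rw [g.symm x (Z x) (X x), g.symm x (Z x) (Y x)]
    ring
  · intro Z Z' hZ hZ'
    simp only [koszul, mlieBracket_add_right hZ hZ']
    simp [mvfderiv_fun_add (g.mdifferentiableAt_inner hX hZ) (g.mdifferentiableAt_inner hX hZ'),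
      mvfderiv_fun_add (g.mdifferentiableAt_inner hY hZ) (g.mdifferentiableAt_inner hY hZ')]
    ring

theorem koszul_add_middle (g : SmoothMetric I M) {X Y Y' Z : Π x : M, TangentSpace I x} {x : M}
    (hX : MDiffAt (T% X) x) (hY : MDiffAt (T% Y) x) (hY' : MDiffAt (T% Y') x)
    (hZ : MDiffAt (T% Z) x) :
    koszul g X (Y + Y') Z x = koszul g X Y Z x + koszul g X Y' Z x := by
  have : CompleteSpace E := FiniteDimensional.complete ℝ E
  simp only [koszul, mlieBracket_add_right hY hY', mlieBracket_add_left hY hY']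
  simp [mvfderiv_fun_add (g.mdifferentiableAt_inner hY hZ) (g.mdifferentiableAt_inner hY' hZ),
    mvfderiv_fun_add (g.mdifferentiableAt_inner hX hY) (g.mdifferentiableAt_inner hX hY')]
  ring

theorem koszul_smul_middle (g : SmoothMetric I M) {X Y Z : Π x : M, TangentSpace I x} {f : M → ℝ}
    {x : M} (hf : MDiffAt f x) (hX : MDiffAt (T% X) x) (hY : MDiffAt (T% Y) x)
    (hZ : MDiffAt (T% Z) x) :
    koszul g X (f • Y) Z x
      = f x * koszul g X Y Z x + 2 * (d% f x (X x) * g.inner x (Y x) (Z x)) := by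
  have : CompleteSpace E := FiniteDimensional.complete ℝ E
  simp only [koszul, mlieBracket_smul_right hf hY, mlieBracket_smul_left hf hY]
  simp [mvfderiv_fun_mul hf (g.mdifferentiableAt_inner hY hZ),
    mvfderiv_fun_mul hf (g.mdifferentiableAt_inner hX hY)]
  rw [g.symm x (Y x) (X x)]
  ring

theorem exists_koszul (g : SmoothMetric I M) (Y : Π x : M, TangentSpace I x) (x : M) :
    ∃ L : TangentSpace I x →L[ℝ] TangentSpace I x, MDiffAt (T% Y) x →
      ∀ X Z : Π x : M, TangentSpace I x, MDiffAt (T% X) x → MDiffAt (T% Z) x →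
        2 * g.inner x (L (X x)) (Z x) = koszul g X Y Z x := by
  by_cases hY : MDiffAt (T% Y) x
  swap
  · exact ⟨0, fun h ↦ absurd h hY⟩
  have : FiniteDimensional ℝ (TangentSpace I x) := inferInstanceAs (FiniteDimensional ℝ E)
  have : T2Space (TangentSpace I x) := inferInstanceAs (T2Space E)
  let B := TensorialAt.mkHom₂ (I := I) (F := E) (F' := E) 
    (fun X Z : Π x : M, TangentSpace I x ↦ koszul g X Y Z x) x
    (fun Z hZ ↦ tensorialAt_koszul_left g hY hZ) (fun X hX ↦ tensorialAt_koszul_right g hX hY)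
  have hB : ∀ X Z : Π x : M, TangentSpace I x, MDiffAt (T% X) x → MDiffAt (T% Z) x →
      B (X x) (Z x) = koszul g X Y Z x := fun X Z hX hZ ↦
    TensorialAt.mkHom₂_apply (fun Z hZ ↦ tensorialAt_koszul_left g hY hZ)
      (fun X hX ↦ tensorialAt_koszul_right g hX hY) hX hZ
  let T : TangentSpace I x →ₗ[ℝ] Module.Dual ℝ (TangentSpace I x) :=
    ContinuousLinearMap.coeLM ℝ ∘ₗ (g.inner x).toLinearMap
  have hTinj : Function.Injective T := fun u v huv ↦
    SmoothMetric.ext_inner g fun w ↦ LinearMap.congr_fun huv w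
  have hTsurj : Function.Surjective T :=
    (LinearMap.injective_iff_surjective_of_finrank_eq_finrank
      (Subspace.dual_finrank_eq (K := ℝ) (V := TangentSpace I x)).symm).1 hTinj
  let e := LinearEquiv.ofBijective T ⟨hTinj, hTsurj⟩
  let L : TangentSpace I x →ₗ[ℝ] TangentSpace I x :=
    (1 / 2 : ℝ) • (e.symm.toLinearMap ∘ₗ ContinuousLinearMap.coeLM ℝ ∘ₗ B.toLinearMap)
  refine ⟨LinearMap.toContinuousLinearMap L, fun _ X Z hX hZ ↦ ?_⟩
  rw [← hB X Z hX hZ]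
  have h3 : g.inner x (e.symm (ContinuousLinearMap.coeLM ℝ (B (X x)))) (Z x) = B (X x) (Z x) :=
    LinearMap.congr_fun (e.apply_symm_apply (ContinuousLinearMap.coeLM ℝ (B (X x)))) (Z x)
  simp only [LinearMap.coe_toContinuousLinearMap', L, map_smul,
    smul_apply, LinearMap.comp_apply, smul_eq_mul]
  erw [h3]
  ring

/-- Every smooth Riemannian metric has a Levi-Civita connection. -/
theorem exists_isLeviCivita (g : SmoothMetric I M) :
    ∃ cov : AffineConnection I M, IsLeviCivita g cov := by
  have : CompleteSpace E := FiniteDimensional.complete ℝ E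
  choose c hc using exists_koszul g
  have key : ∀ {Y : Π x : M, TangentSpace I x} {x : M}, MDiffAt (T% Y) x →
      ∀ {X Z : Π x : M, TangentSpace I x}, MDiffAt (T% X) x → MDiffAt (T% Z) x →
        2 * g.inner x (c Y x (X x)) (Z x) = koszul g X Y Z x :=
    fun hY X Z hX hZ ↦ hc _ _ hY X Z hX hZ
  have hext : ∀ {x : M} (v : TangentSpace I x),
      MDiffAt (T% (extend E v : Π x : M, TangentSpace I x)) x :=
    fun v ↦ mdifferentiableAt_extend ..
  refine ⟨⟨c, ⟨?_, ?_⟩⟩, ⟨?_, ?_⟩⟩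
  · intro Y Y' x hY hY' _
    ext1 v
    refine SmoothMetric.ext_inner g fun w ↦ ?_
    have h1 := key (mdifferentiableAt_add_section hY hY') (hext v) (hext w)
    have h2 := key hY (hext v) (hext w)
    have h3 := key hY' (hext v) (hext w)
    have h4 := koszul_add_middle g (hext v) hY hY' (hext w)
    simp only [extend_apply_self, Pi.add_def, add_apply, map_add] at *
    linarith
  · intro Y f x hY hf _
    ext1 v
    refine SmoothMetric.ext_inner g fun w ↦ ?_
    have h1 := key (hf.smul_section hY) (hext v) (hext w)
    have h2 := key hY (hext v) (hext w)
    have h4 := koszul_smul_middle g hf (hext v) hY (hext w)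
    simp only [extend_apply_self] at h1 h2 h4
    simp
    linear_combination (1 / 2) * h1 + (1 / 2) * h4 - (f x / 2) * h2
  · intro X Y x hX hY
    refine SmoothMetric.ext_inner g fun w ↦ ?_
    have h1 := key hY hX (hext w)
    have h2 := key hX hY (hext w)
    simp only [koszul, extend_apply_self] at h1 h2
    simp only [map_sub, sub_apply]
    have h3 : mlieBracket I Y X x = - mlieBracket I X Y x := mlieBracket_swap_apply
    have h4 : (fun y ↦ g.inner y (Y y) (X y)) = fun y ↦ g.inner y (X y) (Y y) :=
      funext fun y ↦ g.symm y _ _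
    rw [h3, h4] at h2
    simp only [map_neg, neg_apply] at h2
    linarith
  · intro Y Z x v hY hZ
    have h1 := key hY (hext v) hZ
    have h2 := key hZ (hext v) hY
    simp only [koszul, extend_apply_self] at h1 h2
    have h3 : mlieBracket I Z Y x = - mlieBracket I Y Z x := mlieBracket_swap_apply
    have h4 : (fun y ↦ g.inner y (Z y) (Y y)) = fun y ↦ g.inner y (Y y) (Z y) :=
      funext fun y ↦ g.symm y _ _
    rw [h3, h4] at h2
    simp only [map_neg, neg_apply] at h2
    rw [g.symm x (Y x)]
    linarith

/-- The Levi-Civita connection of a smooth Riemannian metric. -/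
def leviCivita (g : SmoothMetric I M) : AffineConnection I M :=
  (exists_isLeviCivita g).choose

theorem isLeviCivita_leviCivita (g : SmoothMetric I M) : IsLeviCivita g (leviCivita g) :=
  (exists_isLeviCivita g).choose_spec

/-- The curvature `R(X, Y)Z = ∇_X ∇_Y Z - ∇_Y ∇_X Z - ∇_[X, Y] Z` of a connection. -/
def curvatureField (cov : AffineConnection I M) (X Y Z : Π x : M, TangentSpace I x) (x : M) :
    TangentSpace I x :=
  cov (fun y ↦ cov Z y (Y y)) x (X x) - cov (fun y ↦ cov Z y (X y)) x (Y x)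
    - cov Z x (mlieBracket I X Y x)

/-- The unnormalized sectional curvature `g(R(X, Y)Y, X)` of two vector fields at the point `x`. -/
def unnormalizedSectionalCurvature (g : SmoothMetric I M) (X Y : Π x : M, TangentSpace I x)
    (x : M) : ℝ :=
  g.inner x (curvatureField (leviCivita g) X Y Y x) (X x)

end Riemannian

section LieGroup

variable {E : Type*} [NormedAddCommGroup E] [NormedSpace ℝ E]
  {H : Type*} [TopologicalSpace H] {I : ModelWithCorners ℝ E H}
  {G : Type*} [TopologicalSpace G] [ChartedSpace H G] [Group G] [LieGroup I ∞ G]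

/-- The metric `h` is invariant under all left translations `x ↦ a * x`. -/
def IsLeftInvariant (h : SmoothMetric I G) : Prop :=
  ∀ (a x : G) (v w : TangentSpace I x),
    h.inner (a * x) (mfderiv I I (fun y ↦ a * y) x v) (mfderiv I I (fun y ↦ a * y) x w)
      = h.inner x v w

/-- The metric `h` is invariant under all right translations `x ↦ x * a`. -/
def IsRightInvariant (h : SmoothMetric I G) : Prop :=
  ∀ (a x : G) (v w : TangentSpace I x),
    h.inner (x * a) (mfderiv I I (fun y ↦ y * a) x v) (mfderiv I I (fun y ↦ y * a) x w)
      = h.inner x v w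

/-- The metric `h` is bi-invariant. -/
def IsBiInvariant (h : SmoothMetric I G) : Prop :=
  IsLeftInvariant h ∧ IsRightInvariant h

/-- The unnormalized sectional curvature, with respect to `h`, of two elements of the Lie algebra,
regarded as left-invariant vector fields and evaluated at the identity. -/
def lieSectionalCurvature [FiniteDimensional ℝ E] (h : SmoothMetric I G)
    (X Y : GroupLieAlgebra I G) : ℝ :=
  unnormalizedSectionalCurvature h (mulInvariantVectorField X) (mulInvariantVectorField Y) 1

end LieGroup

end

/-! For left-invariant fields the Koszul formula is algebraic, and since `[X, Y] = 0` the curvature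
is `k = h_t(∇_X Y, ∇_X Y) - h_t(∇_X X, ∇_Y Y)` (`exists_lieSectionalCurvature_eq`). As `ad` is skew
for `h_0` (`IsBiInvariant.inner_lie`), the vectors `Φ_t ∇_X X`, `Φ_t ∇_Y Y`, `Φ_t ∇_X Y` equal `[X,
Φ_t X]`, `[Y, Φ_t Y]` and `c = ([X, Φ_t Y] + [Y, Φ_t X]) / 2`, so `k = ⟨c, Φ_t⁻¹ c⟩ - ⟨[X, Φ_t X],
Φ_t⁻¹ [Y, Φ_t Y]⟩`. Every entry vanishes at `t = 0`, where `Φ_0 = id`. Hence `k` vanishes there to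
first order, and `k''(0)` involves only first derivatives of the entries
(`second_derivWithin_bilinear`). With `a = [X, ΨY]` and `b = [Y, ΨX]`, skewness and Jacobi give
`⟨[X, ΨX], [Y, ΨY]⟩ = ⟨a, b⟩`, so `2k''(0) = |a + b|² - 4⟨a, b⟩ = |a - b|²`
(`second_derivWithin_curvature`).

Skewness of `ad` comes from the commutation of left- and right-invariant fields, which is the
symmetry of the mixed second derivative of the multiplication. -/

open scoped Topology

/-! ### Second derivatives of bilinear pairings. -/

section BilinearSecondDerivative

variable {E F : Type*} [NormedAddCommGroup E] [NormedSpace ℝ E]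
  [NormedAddCommGroup F] [NormedSpace ℝ F]

/-- A basis identifies `E →L[ℝ] F` with a finite power of `F`, so regularity may be tested vector by
vector. -/
theorem contDiffWithinAt_clm_of_forall_apply [FiniteDimensional ℝ E] {n : ℕ∞ω}
    {D : Type*} [NormedAddCommGroup D] [NormedSpace ℝ D] {s : Set D} {x : D}
    {f : D → E →L[ℝ] F} (hf : ∀ v, ContDiffWithinAt ℝ n (fun t ↦ f t v) s x) :
    ContDiffWithinAt ℝ n f s x := by
  have hd : Module.finrank ℝ E = Module.finrank ℝ (Fin (Module.finrank ℝ E) → ℝ) :=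
    (Module.finrank_fin_fun ℝ).symm
  let e₁ := ContinuousLinearEquiv.ofFinrankEq hd
  let e₂ := (e₁.arrowCongr (1 : F ≃L[ℝ] F)).trans (ContinuousLinearEquiv.piRing _)
  rw [← Function.id_comp f, ← e₂.symm_comp_self]
  exact e₂.symm.contDiff.contDiffAt.comp_contDiffWithinAt x
    (contDiffWithinAt_pi.mpr fun i ↦ hf _)

theorem ContDiffWithinAt.eventually_hasDerivWithinAt {J : Set ℝ} {a : ℝ} (ha : a ∈ J) {f : ℝ → E}
    (hf : ContDiffWithinAt ℝ 2 f J a) :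
    ∀ᶠ t in 𝓝[J] a, HasDerivWithinAt f (derivWithin f J t) J t := by
  have h := hf.eventually (by simp)
  rw [Set.insert_eq_of_mem ha] at h
  filter_upwards [h] with t ht
  exact (ht.differentiableWithinAt (by simp)).hasDerivWithinAt

/-- The value and the first two derivatives of a pairing of two functions vanishing at a point. -/
theorem second_derivWithin_bilinear (β : E →L[ℝ] F →L[ℝ] ℝ) {J : Set ℝ} {a : ℝ}
    (hJ : UniqueDiffOn ℝ J) (ha : a ∈ J) {f : ℝ → E} {g : ℝ → F} {f' : E} {g' : F}
    (hf : ContDiffWithinAt ℝ 2 f J a) (hg : ContDiffWithinAt ℝ 2 g J a)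
    (hf0 : f a = 0) (hg0 : g a = 0)
    (hf' : HasDerivWithinAt f f' J a) (hg' : HasDerivWithinAt g g' J a) :
    ContDiffWithinAt ℝ 2 (fun t ↦ β (f t) (g t)) J a ∧
    HasDerivWithinAt (fun t ↦ β (f t) (g t)) 0 J a ∧
    iteratedDerivWithin 2 (fun t ↦ β (f t) (g t)) J a = 2 * β f' g' := by
  have hd : ∀ {t : ℝ} {f : ℝ → E} {g : ℝ → F} {u : E} {v : F}, HasDerivWithinAt f u J t →
      HasDerivWithinAt g v J t →
      HasDerivWithinAt (fun t ↦ β (f t) (g t)) (β u (g t) + β (f t) v) J t := by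
    intro t f g u v hu hv
    exact (β.hasFDerivAt.comp_hasDerivWithinAt t hu).clm_apply hv
  have hJa : UniqueDiffWithinAt ℝ J a := hJ a ha
  refine ⟨(β.contDiff.contDiffAt.comp_contDiffWithinAt a hf).clm_apply hg, ?_, ?_⟩
  · simpa [hf0, hg0] using hd hf' hg'
  -- A second derivative at `a` requires the first derivative near `a`, not only at `a`.
  have hev : derivWithin (fun t ↦ β (f t) (g t)) J =ᶠ[𝓝[J] a]
      fun t ↦ β (derivWithin f J t) (g t) + β (f t) (derivWithin g J t) := by
    filter_upwards [hf.eventually_hasDerivWithinAt ha, hg.eventually_hasDerivWithinAt ha,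
      self_mem_nhdsWithin] with t hft hgt ht
    exact (hd hft hgt).derivWithin (hJ t ht)
  have hf2 : DifferentiableWithinAt ℝ (derivWithin f J) J a := by
    have := hf.differentiableWithinAt_iteratedDerivWithin (m := 1) (by norm_num)
      (by rwa [Set.insert_eq_of_mem ha])
    rwa [iteratedDerivWithin_one] at this
  have hg2 : DifferentiableWithinAt ℝ (derivWithin g J) J a := by
    have := hg.differentiableWithinAt_iteratedDerivWithin (m := 1) (by norm_num)
      (by rwa [Set.insert_eq_of_mem ha])
    rwa [iteratedDerivWithin_one] at this
  have h2 := ((hd hf2.hasDerivWithinAt hg').add (hd hf' hg2.hasDerivWithinAt)).derivWithin hJa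
  have h3 := hev.derivWithin_eq_of_mem ha
  rw [show (2 : ℕ) = 1 + 1 from rfl, iteratedDerivWithin_succ, iteratedDerivWithin_one, h3]
  refine h2.trans ?_
  -- The terms with a second derivative of `f` or `g` carry a factor vanishing at `a`; the two cross
  -- terms remain.
  rw [hf'.derivWithin hJa, hg'.derivWithin hJa, hf0, hg0]
  simp
  ring

end BilinearSecondDerivative

/-! ### The second variation on a Lie algebra. -/

section MetricLieAlgebra

variable {E : Type*} [NormedAddCommGroup E] [NormedSpace ℝ E] [FiniteDimensional ℝ E]

/-- Let `b` be a path of inner products, with `b 0` invariant under the Lie bracket `br`, and let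
`k t = b(∇_X Y, ∇_X Y) - b(∇_X X, ∇_Y Y)` be the curvature of a commuting pair. -/
theorem second_derivWithin_curvature {J : Set ℝ} (hJ : UniqueDiffOn ℝ J) (hJ0 : (0 : ℝ) ∈ J)
    (br : E →ₗ[ℝ] E →ₗ[ℝ] E) (br_self : ∀ x, br x x = 0)
    (jacobi : ∀ x y z, br x (br y z) = br (br x y) z + br y (br x z))
    (b : ℝ → E →L[ℝ] E →L[ℝ] ℝ) (b_symm : ∀ v w, b 0 v w = b 0 w v)
    (b_pos : ∀ v, v ≠ 0 → 0 < b 0 v v)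
    (b_skew : ∀ x y z, b 0 (br x y) z = -b 0 y (br x z))
    (b_smooth : ∀ v w, ContDiffWithinAt ℝ 2 (fun t ↦ b t v w) J 0)
    (Φ : ℝ → E →ₗ[ℝ] E) (hΦ : ∀ t ∈ J, ∀ v w, b t v w = b 0 (Φ t v) w)
    (Ψ : E →ₗ[ℝ] E) (hΨ : ∀ v, HasDerivWithinAt (fun t ↦ Φ t v) (Ψ v) J 0)
    (X Y : E) (hXY : br X Y = 0) (k : ℝ → ℝ)
    (hk : ∀ t ∈ J, ∃ A B C : E,
      (∀ Z, b t A Z = -b t X (br X Z)) ∧ (∀ Z, b t B Z = -b t Y (br Y Z)) ∧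
      (∀ Z, 2 * b t C Z = -b t Y (br X Z) - b t X (br Y Z)) ∧ k t = b t C C - b t A B) :
    ContDiffWithinAt ℝ 2 k J 0 ∧ k 0 = 0 ∧ derivWithin k J 0 = 0 ∧
    2 * iteratedDerivWithin 2 k J 0
      = b 0 (br X (Ψ Y) + br (Ψ X) Y) (br X (Ψ Y) + br (Ψ X) Y) := by
  have br_swap : ∀ x y, br x y = -br y x := by
    intro x y
    have h := br_self (x + y)
    simp only [map_add, LinearMap.add_apply, br_self] at h
    rw [eq_neg_iff_add_eq_zero]
    simpa [add_comm] using h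
  have b_inj : ∀ {u v}, (∀ w, b 0 u w = b 0 v w) → u = v := by
    intro u v h
    by_contra hne
    have h1 := b_pos (u - v) (sub_ne_zero.2 hne)
    have h2 := h (u - v)

    simp only [map_sub, sub_apply] at h1 h2
    linarith
  let P : ℝ → E →L[ℝ] E := fun t ↦ LinearMap.toContinuousLinearMap (Φ t)
  have hP0 : P 0 = ((1 : E ≃L[ℝ] E) : E →L[ℝ] E) := by
    ext v
    exact b_inj fun w ↦ (hΦ 0 hJ0 v w).symm
  have hP0v : ∀ v, Φ 0 v = v := fun v ↦ DFunLike.congr_fun hP0 v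
  have flat_inj : Function.Injective (b 0) := fun u v h ↦ b_inj fun w ↦ by rw [h]
  -- `S` raises an index with `b 0`: `Φ t v = S (b t v)`, so `Φ` inherits its regularity from `b`.
  obtain ⟨S, hS⟩ : ∃ S : (E →L[ℝ] ℝ) →L[ℝ] E, ∀ v, S (b 0 v) = v := by
    obtain ⟨S, hS⟩ := (b 0).toLinearMap.exists_leftInverse_of_injective
      (LinearMap.ker_eq_bot.2 flat_inj)
    exact ⟨LinearMap.toContinuousLinearMap S, fun v ↦ LinearMap.congr_fun hS v⟩
  have hΦv : ∀ v, ContDiffWithinAt ℝ 2 (fun t ↦ Φ t v) J 0 := by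
    intro v
    have h1 : ContDiffWithinAt ℝ 2 (fun t ↦ b t v) J 0 :=
      contDiffWithinAt_clm_of_forall_apply fun w ↦ b_smooth v w
    have h2 : ContDiffWithinAt ℝ 2 (fun t ↦ S (b t v)) J 0 :=
      S.contDiff.contDiffAt.comp_contDiffWithinAt 0 h1
    have h3 : ∀ t ∈ J, Φ t v = S (b t v) := by
      intro t ht
      rw [← hS (Φ t v)]
      congr 1
      ext w
      exact (hΦ t ht v w).symm
    exact h2.congr_of_mem h3 hJ0
  have hP : ContDiffWithinAt ℝ 2 P J 0 := contDiffWithinAt_clm_of_forall_apply hΦv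
  have hQ : ContDiffWithinAt ℝ 2 (fun t ↦ (P t).inverse) J 0 := by
    have h1 : ContDiffAt ℝ 2 ContinuousLinearMap.inverse (P 0) := by
      rw [hP0]; exact contDiffAt_map_inverse _
    exact h1.comp_contDiffWithinAt 0 hP
  -- `inverse` is `0` on non-invertible maps; invertibility near `P 0 = id` is enough for
  -- derivatives at `0`.
  have hQP : ∀ᶠ t in 𝓝[J] 0, ∀ v, (P t).inverse (Φ t v) = v := by
    have h1 : Filter.Tendsto P (𝓝[J] 0) (𝓝 (P 0)) := hP.continuousWithinAt
    rw [hP0] at h1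
    filter_upwards [h1.eventually (ContinuousLinearEquiv.nhds (1 : E ≃L[ℝ] E))] with t ht v
    obtain ⟨e, he⟩ := ht
    rw [show Φ t v = P t v from rfl, ← he, ContinuousLinearMap.inverse_equiv]
    exact e.symm_apply_apply v
  have hQ0 : (P 0).inverse = ContinuousLinearMap.id ℝ E := by
    rw [hP0, ContinuousLinearMap.inverse_equiv]; rfl
  -- `c t` is `Φ_t ∇_X Y`, and `d x t` is `Φ_t ∇_x x`.
  let c : ℝ → E := fun t ↦ (1 / 2 : ℝ) • (br X (Φ t Y) + br Y (Φ t X))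
  let d : E → ℝ → E := fun x t ↦ br x (Φ t x)
  have hbr : ∀ x v, ContDiffWithinAt ℝ 2 (fun t ↦ br x (Φ t v)) J 0 ∧
      HasDerivWithinAt (fun t ↦ br x (Φ t v)) (br x (Ψ v)) J 0 := fun x v ↦
    ⟨(LinearMap.toContinuousLinearMap (br x)).contDiff.contDiffAt.comp_contDiffWithinAt 0 (hΦv v),
      (LinearMap.toContinuousLinearMap (br x)).hasFDerivAt.comp_hasDerivWithinAt 0 (hΨ v)⟩
  have hc : ContDiffWithinAt ℝ 2 c J 0 := ((hbr X Y).1.add (hbr Y X).1).const_smul _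
  have hc' : HasDerivWithinAt c ((1 / 2 : ℝ) • (br X (Ψ Y) + br Y (Ψ X))) J 0 :=
    ((hbr X Y).2.add (hbr Y X).2).const_smul _
  have hc0 : c 0 = 0 := by simp [c, hP0v, hXY, br_swap Y X]
  have hd0 : ∀ x, d x 0 = 0 := fun x ↦ by simp [d, hP0v, br_self]
  -- Because `f 0 = 0` and `P 0 = id`, applying `(P t).inverse` does not change the derivative at
  -- `0`.
  have hQf : ∀ {f : ℝ → E} {f' : E}, ContDiffWithinAt ℝ 2 f J 0 → f 0 = 0 →
      HasDerivWithinAt f f' J 0 → ContDiffWithinAt ℝ 2 (fun t ↦ (P t).inverse (f t)) J 0 ∧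
        (P 0).inverse (f 0) = 0 ∧ HasDerivWithinAt (fun t ↦ (P t).inverse (f t)) f' J 0 := by
    intro f f' hf hf0 hf'
    refine ⟨hQ.clm_apply hf, by simp [hf0], ?_⟩
    have := ((hQ.differentiableWithinAt (by simp)).hasDerivWithinAt).clm_apply hf'
    simpa [hf0, hQ0] using this
  obtain ⟨hQc, hQc0, hQc'⟩ := hQf hc hc0 hc'
  obtain ⟨hQd, hQd0, hQd'⟩ := hQf (hbr Y Y).1 (hd0 Y) (hbr Y Y).2
  obtain ⟨k1, k2, k3⟩ := second_derivWithin_bilinear (b 0) hJ hJ0 hc hQc hc0 hQc0 hc' hQc'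
  obtain ⟨l1, l2, l3⟩ := second_derivWithin_bilinear (b 0) hJ hJ0 (hbr X X).1 hQd (hd0 X) hQd0
    (hbr X X).2 hQd'
  have hkev : k =ᶠ[𝓝[J] 0] (fun t ↦ b 0 (c t) ((P t).inverse (c t)))
      - fun t ↦ b 0 (br X (Φ t X)) ((P t).inverse (br Y (Φ t Y))) := by
    filter_upwards [hQP, self_mem_nhdsWithin] with t hQt ht
    obtain ⟨A, B, C, hA, hB, hC, hkt⟩ := hk t ht
    have eA : Φ t A = br X (Φ t X) := b_inj fun Z ↦ by
      rw [← hΦ t ht, hA, b_skew, hΦ t ht]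
    have eB : Φ t B = br Y (Φ t Y) := b_inj fun Z ↦ by
      rw [← hΦ t ht, hB, b_skew, hΦ t ht]
    have eC : Φ t C = c t := b_inj fun Z ↦ by
      have := hC Z
      rw [hΦ t ht, hΦ t ht, hΦ t ht] at this
      simp only [c, map_smul, map_add, add_apply, smul_apply, b_skew, smul_eq_mul]
      linarith
    rw [hkt, Pi.sub_apply, hΦ t ht C, hΦ t ht A, ← eC, ← eA, ← eB, hQt, hQt]
  have hk0 := hkev.self_of_nhdsWithin hJ0
  refine ⟨(k1.sub l1).congr_of_eventuallyEq hkev hk0, ?_, ?_, ?_⟩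
  · rw [hk0, Pi.sub_apply, hc0, hP0v, br_self]; simp
  · rw [hkev.derivWithin_eq_of_mem hJ0, (k2.sub l2).derivWithin (hJ 0 hJ0), sub_zero]
  · rw [hkev.iteratedDerivWithin_eq hk0, iteratedDerivWithin_sub hJ0 hJ k1 l1, k3, l3]
    -- `ad X` and `ad Y` commute, by Jacobi and `[X, Y] = 0`.
    have e1 : b 0 (br X (Ψ X)) (br Y (Ψ Y)) = b 0 (br Y (Ψ X)) (br X (Ψ Y)) := by
      rw [b_skew, b_skew, jacobi X Y, hXY]
      simp
    -- What remains is `|a + b|² - 4⟨a, b⟩ = |a - b|²`.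
    rw [e1, br_swap (Ψ X) Y]
    simp only [map_smul, map_add, map_neg, add_apply, smul_apply, neg_apply, smul_eq_mul]
    rw [b_symm (br X (Ψ Y)) (br Y (Ψ X))]
    ring

end MetricLieAlgebra

/-! ### Commuting fields from symmetry of second derivatives. -/

section SymmetricSecondDerivative

variable {E : Type*} [NormedAddCommGroup E] [NormedSpace ℝ E]

/-- The vector fields `v ↦ D₂μ(v, e) x` and `v ↦ D₁μ(e, v) y` associated to a map `μ` of two
variables commute at `e`, if their values at `e` are `x` and `y`. -/
theorem lieBracket_eq_zero_of_partial_fderiv {μ : E × E → E} {e x y : E} {V W : E → E}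
    (hμ : ContDiffAt ℝ 2 μ (e, e))
    (hV : V =ᶠ[𝓝 e] fun v ↦ fderiv ℝ μ (v, e) (0, x))
    (hW : W =ᶠ[𝓝 e] fun v ↦ fderiv ℝ μ (e, v) (y, 0)) (hVe : V e = x) (hWe : W e = y) :
    VectorField.lieBracketWithin ℝ V W Set.univ e = 0 := by
  have hsymm : IsSymmSndFDerivAt ℝ μ (e, e) := hμ.isSymmSndFDerivAt (by simp)
  have hd : HasFDerivAt (fderiv ℝ μ) (fderiv ℝ (fderiv ℝ μ) (e, e)) (e, e) :=
    ((hμ.fderiv_right (m := 1) (by norm_num)).differentiableAt (by simp)).hasFDerivAt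
  have h1 : HasFDerivAt (fun v : E ↦ (v, e)) (ContinuousLinearMap.inl ℝ E E) e :=
    (hasFDerivAt_id e).prodMk (hasFDerivAt_const e e)
  have h2 : HasFDerivAt (fun v : E ↦ (e, v)) (ContinuousLinearMap.inr ℝ E E) e :=
    (hasFDerivAt_const e e).prodMk (hasFDerivAt_id e)
  have hV' := ((HasFDerivAt.comp (f := fun v : E ↦ (v, e)) e hd h1).clm_apply
    (hasFDerivAt_const (0, x) e)).congr_of_eventuallyEq hV
  have hW' := ((HasFDerivAt.comp (f := fun v : E ↦ (e, v)) e hd h2).clm_apply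
    (hasFDerivAt_const (y, 0) e)).congr_of_eventuallyEq hW
  rw [VectorField.lieBracketWithin_univ, VectorField.lieBracket, hV'.fderiv, hW'.fderiv, hVe, hWe]
  -- The two terms of the bracket are the mixed second derivatives of `μ` in the two orders.
  simp [hsymm.eq (0, x) (y, 0)]

end SymmetricSecondDerivative

/-! ### Left- and right-invariant vector fields. -/

section InvariantVectorFields

open Bundle VectorField

variable {E : Type*} [NormedAddCommGroup E] [NormedSpace ℝ E]
  {H : Type*} [TopologicalSpace H] {I : ModelWithCorners ℝ E H}
  {G : Type*} [TopologicalSpace G] [ChartedSpace H G] [Group G]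

theorem LieGroup.minSmoothness_three [LieGroup I ∞ G] : LieGroup I (minSmoothness ℝ 3) G :=
  LieGroup.of_le (n := ∞) (by simp; norm_cast)

/-- The right-invariant vector field with value `v` at the identity. -/
noncomputable def rightInvariantVectorField (v : GroupLieAlgebra I G) (g : G) : TangentSpace I g :=
  mfderiv I I (fun x ↦ x * g) (1 : G) v

theorem mulInvariantVectorField_one (x : GroupLieAlgebra I G) :
    mulInvariantVectorField x (1 : G) = x := by
  have h : (fun y : G ↦ 1 * y) = id := funext one_mul
  have := DFunLike.congr_fun (mfderiv_id (I := I) (x := (1 : G))) x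
  rw [← h] at this
  exact this

theorem rightInvariantVectorField_one (x : GroupLieAlgebra I G) :
    rightInvariantVectorField x (1 : G) = x := by
  have h : (fun y : G ↦ y * 1) = id := funext mul_one
  have := DFunLike.congr_fun (mfderiv_id (I := I) (x := (1 : G))) x
  rw [← h] at this
  exact this

variable [LieGroup I ∞ G]

/-- The field at `g` is the tangent map of the multiplication applied to `(v, 0)` at `(1, g)`. -/
theorem contMDiff_rightInvariantVectorField (v : GroupLieAlgebra I G) :
    CMDiff 1
      (fun (g : G) ↦ (rightInvariantVectorField v g : TangentBundle I G)) := by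
  let fg : G → TangentBundle I G := fun g ↦ TotalSpace.mk' E g 0
  have sfg : CMDiff 1 fg := contMDiff_zeroSection _ _
  let fv : G → TangentBundle I G := fun _ ↦ TotalSpace.mk' E 1 v
  have sfv : CMDiff 1 fv := contMDiff_const
  let F₁ : G → (TangentBundle I G × TangentBundle I G) := fun g ↦ (fv g, fg g)
  have S₁ : CMDiff 1 F₁ := sfv.prodMk sfg
  let F₂ : (TangentBundle I G × TangentBundle I G) → TangentBundle (I.prod I) (G × G) :=
    (equivTangentBundleProd I G I G).symm
  have S₂ : CMDiff 1 F₂ := contMDiff_equivTangentBundleProd_symm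
  let F₃ : TangentBundle (I.prod I) (G × G) → TangentBundle I G :=
    tangentMap% (fun (p : G × G) ↦ p.1 * p.2)
  have S₃ : CMDiff 1 F₃ :=
    ContMDiff.contMDiff_tangentMap (contMDiff_mul I ∞) (m := 1) (by norm_cast)
  let S := (S₃.comp S₂).comp S₁
  convert! S with g
  · simp [F₁, F₂, F₃, fg, fv]
  · simp only [Function.comp_apply, tangentMap, F₃, F₂, F₁, fg, fv]
    rw [mfderiv_prod_eq_add_apply ((contMDiff_mul I ∞).mdifferentiableAt (by simp))]
    let a : E := mfderiv I I (fun x : G ↦ x * g) 1 v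
    exact ((congrArg (fun w : E ↦ a + w)
      (map_zero (mfderiv I I (fun z : G ↦ 1 * z) g))).trans (add_zero a)).symm

/-- The multiplication of a Lie group read in the chart at the identity. -/
noncomputable def chartMul (I : ModelWithCorners ℝ E H) (G : Type*) [TopologicalSpace G]
    [ChartedSpace H G] [Group G] (p : E × E) : E :=
  extChartAt I (1 : G) ((extChartAt I (1 : G)).symm p.1 * (extChartAt I (1 : G)).symm p.2)

theorem contDiffAt_chartMul [I.Boundaryless] :
    ContDiffAt ℝ 2 (chartMul I G) (extChartAt I (1 : G) 1, extChartAt I (1 : G) 1) := by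
  rw [← contMDiffAt_iff_contDiffAt]
  have hs : ContMDiffAt 𝓘(ℝ, E) I ∞ (extChartAt I (1 : G)).symm (extChartAt I (1 : G) 1) :=
    (contMDiffOn_extChartAt_symm (1 : G)).contMDiffAt (extChartAt_target_mem_nhds 1)
  have h1 : ContMDiffAt 𝓘(ℝ, E × E) I ∞ (fun p : E × E ↦ (extChartAt I (1 : G)).symm p.1)
    (extChartAt I (1 : G) 1, extChartAt I (1 : G) 1) :=
    ContMDiffAt.comp (I' := 𝓘(ℝ, E)) _ hs contDiff_fst.contMDiff.contMDiffAt
  have h2 : ContMDiffAt 𝓘(ℝ, E × E) I ∞ (fun p : E × E ↦ (extChartAt I (1 : G)).symm p.2)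
    (extChartAt I (1 : G) 1, extChartAt I (1 : G) 1) :=
    ContMDiffAt.comp (I' := 𝓘(ℝ, E)) _ hs contDiff_snd.contMDiff.contMDiffAt
  have h3 := h1.mul h2
  have h4 : ContMDiffAt I 𝓘(ℝ, E) ∞ (extChartAt I (1 : G))
      ((extChartAt I (1 : G)).symm (extChartAt I (1 : G) 1) *
        (extChartAt I (1 : G)).symm (extChartAt I (1 : G) 1)) := by
    simp only [extChartAt_to_inv, mul_one]
    exact contMDiffAt_extChartAt
  exact (ContMDiffAt.comp (I' := I) (f := fun p : E × E ↦ (extChartAt I (1 : G)).symm p.1 *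
    (extChartAt I (1 : G)).symm p.2) _ h4 h3).of_le (by norm_cast)

/-- Chain rule in the chart; `F` will be the translation taking `1` to the point with coordinate
`v`. -/
theorem inverse_mfderivWithin_extChartAt_symm_mfderiv [I.Boundaryless] {F : G → G} {v : E}
    (hv : v ∈ (extChartAt I (1 : G)).target) (hF : MDiffAt F (1 : G))
    (hF1 : F 1 = (extChartAt I (1 : G)).symm v) (x : GroupLieAlgebra I G) :
    ((mfderiv[Set.range I] (extChartAt I (1 : G)).symm v).inverse (mfderiv I I F 1 x : E) : E) =
      fderiv ℝ (extChartAt I (1 : G) ∘ F ∘ (extChartAt I (1 : G)).symm) (extChartAt I (1 : G) 1)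
        x := by
  have : IsManifold I 1 G := IsManifold.of_le (n := ∞) (by norm_cast)
  have hφ : MDiffAt (extChartAt I (1 : G)) (F 1) := by
    rw [hF1]
    exact mdifferentiableAt_extChartAt
      (by rw [← extChartAt_source (I := I)]; exact (extChartAt I (1 : G)).map_target hv)
  have h1 : (mfderiv[Set.range I] (extChartAt I (1 : G)).symm v).inverse =
      mfderiv% (extChartAt I (1 : G)) ((extChartAt I (1 : G)).symm v) :=
    ContinuousLinearMap.inverse_eq
      (mfderivWithin_extChartAt_symm_comp_mfderiv_extChartAt hv)
      (mfderiv_extChartAt_comp_mfderivWithin_extChartAt_symm hv)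
  have h2 := mfderiv_comp (I' := I) (1 : G) hφ hF
  have h3 := (hφ.comp (1 : G) hF).mfderiv
  rw [h2, I.range_eq_univ, fderivWithin_univ] at h3
  rw [h1]
  rw [hF1] at h3
  exact DFunLike.congr_fun h3 x

theorem eventually_differentiableAt_chartMul [I.Boundaryless] :
    ∀ᶠ v in 𝓝 (extChartAt I (1 : G) 1),
      DifferentiableAt ℝ (chartMul I G) (v, extChartAt I (1 : G) 1) ∧
      DifferentiableAt ℝ (chartMul I G) (extChartAt I (1 : G) 1, v) := by
  have h2 : ∀ᶠ p in 𝓝 (extChartAt I (1 : G) 1, extChartAt I (1 : G) 1),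
      ContDiffAt ℝ 2 (chartMul I G) p := contDiffAt_chartMul.eventually (by simp)
  have h3 : Filter.Tendsto (fun v ↦ (v, extChartAt I (1 : G) 1)) (𝓝 (extChartAt I (1 : G) 1))
    (𝓝 (extChartAt I (1 : G) 1, extChartAt I (1 : G) 1)) := Continuous.tendsto (by fun_prop) _
  have h4 : Filter.Tendsto (fun v ↦ (extChartAt I (1 : G) 1, v)) (𝓝 (extChartAt I (1 : G) 1))
    (𝓝 (extChartAt I (1 : G) 1, extChartAt I (1 : G) 1)) := Continuous.tendsto (by fun_prop) _
  filter_upwards [h3.eventually h2, h4.eventually h2] with v hv hv'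
  exact ⟨hv.differentiableAt (by simp), hv'.differentiableAt (by simp)⟩

/-- A left translation varies only the second factor of the product, hence the partial derivative in
that slot. -/
theorem mpullbackWithin_mulInvariantVectorField [I.Boundaryless] (x : GroupLieAlgebra I G) :
    mpullbackWithin 𝓘(ℝ, E) I (extChartAt I (1 : G)).symm (mulInvariantVectorField x) (Set.range I)
      =ᶠ[𝓝 (extChartAt I (1 : G) 1)]
        fun v ↦ fderiv ℝ (chartMul I G) (v, (extChartAt I (1 : G) 1)) (0, x) := by
  filter_upwards [extChartAt_target_mem_nhds (I := I) (1 : G),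
    eventually_differentiableAt_chartMul (I := I)] with v hv hd
  have h4 := HasFDerivAt.comp (f := fun w ↦ (v, w)) (extChartAt I (1 : G) 1) hd.1.hasFDerivAt
    ((hasFDerivAt_const v _).prodMk (hasFDerivAt_id _))
  have h5 := inverse_mfderivWithin_extChartAt_symm_mfderiv
    (F := fun y ↦ (extChartAt I (1 : G)).symm v * y) hv
    ((contMDiff_mul_left (I := I) (n := ∞)).mdifferentiableAt (by simp)) (by simp) x
  exact h5.trans (DFunLike.congr_fun h4.fderiv x)

theorem mpullbackWithin_rightInvariantVectorField [I.Boundaryless] (x : GroupLieAlgebra I G) :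
    mpullbackWithin 𝓘(ℝ, E) I (extChartAt I (1 : G)).symm (rightInvariantVectorField x)
      (Set.range I) =ᶠ[𝓝 (extChartAt I (1 : G) 1)]
        fun v ↦ fderiv ℝ (chartMul I G) ((extChartAt I (1 : G) 1), v) (x, 0) := by
  filter_upwards [extChartAt_target_mem_nhds (I := I) (1 : G),
    eventually_differentiableAt_chartMul (I := I)] with v hv hd
  have h4 := HasFDerivAt.comp (f := fun w ↦ (w, v)) (extChartAt I (1 : G) 1) hd.2.hasFDerivAt
    ((hasFDerivAt_id _).prodMk (hasFDerivAt_const v _))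
  have h5 := inverse_mfderivWithin_extChartAt_symm_mfderiv
    (F := fun y ↦ y * (extChartAt I (1 : G)).symm v) hv
    ((contMDiff_mul_right (I := I) (n := ∞)).mdifferentiableAt (by simp)) (by simp) x
  exact h5.trans (DFunLike.congr_fun h4.fderiv x)

/-- Left-invariant and right-invariant vector fields commute at the identity. -/
theorem mlieBracket_mulInvariantVectorField_rightInvariantVectorField [I.Boundaryless]
    (x y : GroupLieAlgebra I G) :
    mlieBracket I (mulInvariantVectorField x) (rightInvariantVectorField y) (1 : G) = 0 := by
  have : IsManifold I 1 G := IsManifold.of_le (n := ∞) (by norm_cast)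
  -- At its base point the chart has identity derivative, so the pullback does not change the value
  -- there.
  have hval : ∀ V : Π g : G, TangentSpace I g,
      mpullbackWithin 𝓘(ℝ, E) I (extChartAt I (1 : G)).symm V (Set.range I)
        (extChartAt I (1 : G) 1) = V 1 := by
    intro V
    rw [mpullbackWithin_apply]
    refine Eq.trans ?_ (congrArg (fun g ↦ (V g : E)) (extChartAt_to_inv (I := I) (1 : G)))
    rw [mfderivWithin_range_extChartAt_symm]
    exact DFunLike.congr_fun (ContinuousLinearMap.inverse_id (R := ℝ) (M := E)) _
  have h : lieBracketWithin ℝ _ _ _ _ = _ :=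
    lieBracket_eq_zero_of_partial_fderiv (contDiffAt_chartMul (I := I) (G := G))
      (mpullbackWithin_mulInvariantVectorField x) (mpullbackWithin_rightInvariantVectorField y)
      ((hval _).trans (mulInvariantVectorField_one x))
      ((hval _).trans (rightInvariantVectorField_one y))
  rw [← mlieBracketWithin_univ, mlieBracketWithin_apply]
  simp only [Set.preimage_univ, I.range_eq_univ, Set.univ_inter]
  rw [I.range_eq_univ] at h
  exact (congrArg _ h).trans (map_zero _)
end InvariantVectorFields

/-! ### Levi-Civita connection and curvature of invariant metrics. -/

section LeftInvariantMetric

open Bundle VectorField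

variable {E : Type*} [NormedAddCommGroup E] [NormedSpace ℝ E]
  {H : Type*} [TopologicalSpace H] {I : ModelWithCorners ℝ E H}
  {G : Type*} [TopologicalSpace G] [ChartedSpace H G] [Group G] [LieGroup I ∞ G]

/-- Taking the vectors in `E` avoids a transport between the tangent spaces at `g * 1` and `g`. -/
theorem SmoothMetric.inner_congr_point (h : SmoothMetric I G) {a b : G} (hab : a = b) (v w : E) :
    h.inner a v w = h.inner b v w := by
  subst hab; rfl

theorem IsLeftInvariant.inner_mulInvariantVectorField {h : SmoothMetric I G}
    (hl : IsLeftInvariant h) (g : G) (X Y : GroupLieAlgebra I G) :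
    h.inner g (mulInvariantVectorField X g) (mulInvariantVectorField Y g) = h.inner 1 X Y :=
  (h.inner_congr_point (mul_one g).symm _ _).trans (hl g 1 X Y)

theorem IsRightInvariant.inner_rightInvariantVectorField {h : SmoothMetric I G}
    (hr : IsRightInvariant h) (g : G) (X Y : GroupLieAlgebra I G) :
    h.inner g (rightInvariantVectorField X g) (rightInvariantVectorField Y g) = h.inner 1 X Y :=
  (h.inner_congr_point (one_mul g).symm _ _).trans (hr g 1 X Y)

theorem mdifferentiableAt_mulInvariantVectorField' (X : GroupLieAlgebra I G) (g : G) :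
    MDiffAt (T% (mulInvariantVectorField X : Π g : G, TangentSpace I g)) g := by
  have := LieGroup.minSmoothness_three (I := I) (G := G)
  exact mdifferentiableAt_mulInvariantVectorField X

theorem mdifferentiableAt_rightInvariantVectorField (X : GroupLieAlgebra I G) (g : G) :
    MDiffAt (T% (rightInvariantVectorField X : Π g : G, TangentSpace I g)) g :=
  (contMDiff_rightInvariantVectorField X).mdifferentiable (by simp) g

theorem IsLeviCivita.inner_mulInvariantVectorField_skew {h : SmoothMetric I G}
    {cov : AffineConnection I G} (hc : IsLeviCivita h cov) (hl : IsLeftInvariant h)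
    (g : G) (v : TangentSpace I g) (Y Z : GroupLieAlgebra I G) :
    h.inner g (cov (mulInvariantVectorField Y) g v) (mulInvariantVectorField Z g) +
      h.inner g (mulInvariantVectorField Y g) (cov (mulInvariantVectorField Z) g v) = 0 := by
  rw [← hc.metric v (mdifferentiableAt_mulInvariantVectorField' Y g)
    (mdifferentiableAt_mulInvariantVectorField' Z g),
    funext fun y ↦ hl.inner_mulInvariantVectorField y Y Z, mvfderiv_const]
  rfl

variable [FiniteDimensional ℝ E]

theorem mlieBracket_mulInvariantVectorField (X Y : GroupLieAlgebra I G) :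
    mlieBracket I (mulInvariantVectorField X) (mulInvariantVectorField Y) =
      (mulInvariantVectorField ⁅X, Y⁆ : Π g : G, TangentSpace I g) := by
  have := LieGroup.minSmoothness_three (I := I) (G := G)
  have : CompleteSpace E := FiniteDimensional.complete ℝ E
  exact (mulInvariantVector_mlieBracket X Y).symm

/-- The derivative of a translation preserves `h`, so it is injective, and surjective by dimension.
-/
theorem IsLeftInvariant.exists_mulInvariantVectorField_eq {h : SmoothMetric I G}
    (hl : IsLeftInvariant h) (g : G) (w : TangentSpace I g) :
    ∃ Z : GroupLieAlgebra I G, mulInvariantVectorField Z g = w := by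
  have : FiniteDimensional ℝ (GroupLieAlgebra I G) := inferInstanceAs (FiniteDimensional ℝ E)
  let T : E →ₗ[ℝ] E := (mfderiv I I (fun y : G ↦ g * y) 1).toLinearMap
  have hT : Function.Injective T := by
    rw [← LinearMap.ker_eq_bot, LinearMap.ker_eq_bot']
    intro v hv
    by_contra hne
    have h1 := h.pos 1 v hne
    have h2 := hl.inner_mulInvariantVectorField g v v
    have h3 : mulInvariantVectorField (I := I) v g = 0 := hv
    rw [h3] at h2
    simp only [map_zero] at h2
    linarith
  exact LinearMap.injective_iff_surjective.1 hT w

namespace IsLeviCivita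

variable {h : SmoothMetric I G} {cov : AffineConnection I G}

theorem torsion_free_mulInvariantVectorField (hc : IsLeviCivita h cov)
    (g : G) (X Y : GroupLieAlgebra I G) :
    cov (mulInvariantVectorField Y) g (mulInvariantVectorField X g) -
      cov (mulInvariantVectorField X) g (mulInvariantVectorField Y g) =
      mulInvariantVectorField ⁅X, Y⁆ g := by
  rw [hc.torsion_free (mdifferentiableAt_mulInvariantVectorField' X g)
    (mdifferentiableAt_mulInvariantVectorField' Y g), mlieBracket_mulInvariantVectorField]

/-- The Koszul formula for left-invariant vector fields. -/
theorem koszul_mulInvariantVectorField (hc : IsLeviCivita h cov) (hl : IsLeftInvariant h)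
    (g : G) (X Y Z : GroupLieAlgebra I G) :
    2 * h.inner g (cov (mulInvariantVectorField Y) g (mulInvariantVectorField X g))
      (mulInvariantVectorField Z g) =
      h.inner 1 ⁅X, Y⁆ Z - h.inner 1 ⁅X, Z⁆ Y - h.inner 1 ⁅Y, Z⁆ X := by
  have m := hc.inner_mulInvariantVectorField_skew hl g
  have t : ∀ A B C : GroupLieAlgebra I G,
      h.inner g (cov (mulInvariantVectorField B) g (mulInvariantVectorField A g))
        (mulInvariantVectorField C g) -
      h.inner g (cov (mulInvariantVectorField A) g (mulInvariantVectorField B g))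
        (mulInvariantVectorField C g) = h.inner 1 ⁅A, B⁆ C := by
    intro A B C
    rw [← hl.inner_mulInvariantVectorField g ⁅A, B⁆ C,
      ← hc.torsion_free_mulInvariantVectorField g A B, map_sub, sub_apply]
  have m1 := m (mulInvariantVectorField X g) Y Z
  have m2 := m (mulInvariantVectorField Y g) X Z
  have m3 := m (mulInvariantVectorField Z g) X Y
  have t1 := t X Y Z
  have t2 := t X Z Y
  have t3 := t Y Z X
  rw [h.symm g (mulInvariantVectorField _ g)] at m1 m2 m3
  linarith

/-- The covariant derivative of left-invariant vector fields is left-invariant. -/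
theorem cov_mulInvariantVectorField (hc : IsLeviCivita h cov) (hl : IsLeftInvariant h)
    (X Y : GroupLieAlgebra I G) :
    (fun g : G ↦ cov (mulInvariantVectorField Y) g (mulInvariantVectorField X g)) =
      mulInvariantVectorField (cov (mulInvariantVectorField Y) 1 X : GroupLieAlgebra I G) := by
  funext g
  refine SmoothMetric.ext_inner h fun w ↦ ?_
  obtain ⟨Z, rfl⟩ := hl.exists_mulInvariantVectorField_eq g w
  -- The right-hand side of the Koszul formula does not depend on `g`.
  have h1 := hc.koszul_mulInvariantVectorField hl g X Y Z
  have h2 := hc.koszul_mulInvariantVectorField hl 1 X Y Z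
  rw [hl.inner_mulInvariantVectorField]
  rw [mulInvariantVectorField_one, mulInvariantVectorField_one] at h2
  linarith

end IsLeviCivita

/-- The curvature of a commuting pair in the Lie algebra, in terms of `A = ∇_X X`, `B = ∇_Y Y` and
`C = ∇_X Y`. -/
theorem exists_lieSectionalCurvature_eq {h : SmoothMetric I G} (hl : IsLeftInvariant h)
    (X Y : GroupLieAlgebra I G) (hXY : ⁅X, Y⁆ = 0) :
    ∃ A B C : GroupLieAlgebra I G,
      (∀ Z : GroupLieAlgebra I G, h.inner 1 A Z = -h.inner 1 X ⁅X, Z⁆) ∧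
      (∀ Z : GroupLieAlgebra I G, h.inner 1 B Z = -h.inner 1 Y ⁅Y, Z⁆) ∧
      (∀ Z : GroupLieAlgebra I G,
        2 * h.inner 1 C Z = -h.inner 1 Y ⁅X, Z⁆ - h.inner 1 X ⁅Y, Z⁆) ∧
      lieSectionalCurvature h X Y = h.inner 1 C C - h.inner 1 A B := by
  have hc := isLeviCivita_leviCivita h
  let N : GroupLieAlgebra I G → GroupLieAlgebra I G → GroupLieAlgebra I G :=
    fun X Y ↦ leviCivita h (mulInvariantVectorField Y) 1 X
  have hself : ∀ Z : GroupLieAlgebra I G, ⁅Z, Z⁆ = 0 := fun Z ↦ by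
    rw [GroupLieAlgebra.bracket_def, mlieBracket_self]; rfl
  have hK : ∀ A B Z : GroupLieAlgebra I G, 2 * h.inner 1 (N A B) Z =
      h.inner 1 ⁅A, B⁆ Z - h.inner 1 ⁅A, Z⁆ B - h.inner 1 ⁅B, Z⁆ A := by
    intro A B Z
    have := hc.koszul_mulInvariantVectorField hl 1 A B Z
    rwa [mulInvariantVectorField_one, mulInvariantVectorField_one] at this
  have hN : ∀ A B C : GroupLieAlgebra I G, h.inner 1 (N A B) C + h.inner 1 B (N A C) = 0 := by
    intro A B C
    have := hc.inner_mulInvariantVectorField_skew hl 1 A B C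
    rwa [mulInvariantVectorField_one, mulInvariantVectorField_one] at this
  have hsymm : N Y X = N X Y := by
    have := hc.torsion_free_mulInvariantVectorField 1 X Y
    rw [hXY, mulInvariantVectorField_one, mulInvariantVectorField_one,
      mulInvariantVectorField_one] at this
    exact (sub_eq_zero.1 this).symm
  refine ⟨N X X, N Y Y, N X Y, fun Z ↦ ?_, fun Z ↦ ?_, fun Z ↦ ?_, ?_⟩
  · have := hK X X Z
    rw [hself, map_zero, zero_apply, h.symm 1 ⁅X, Z⁆] at this
    linarith
  · have := hK Y Y Z
    rw [hself, map_zero, zero_apply, h.symm 1 ⁅Y, Z⁆] at this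
    linarith
  · have := hK X Y Z
    rw [hXY, map_zero, zero_apply, h.symm 1 ⁅X, Z⁆, h.symm 1 ⁅Y, Z⁆] at this
    linarith
  · have hR : curvatureField (leviCivita h) (mulInvariantVectorField X)
        (mulInvariantVectorField Y) (mulInvariantVectorField Y) 1 =
        N X (N Y Y) - N Y (N X Y) := by
      rw [curvatureField, hc.cov_mulInvariantVectorField hl, hc.cov_mulInvariantVectorField hl,
        mulInvariantVectorField_one, mulInvariantVectorField_one, ← GroupLieAlgebra.bracket_def,
        hXY, map_zero, sub_zero]
    rw [lieSectionalCurvature, unnormalizedSectionalCurvature, hR, mulInvariantVectorField_one,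
      map_sub, sub_apply]
    -- Skewness of `∇_X` and `∇_Y` moves the outer derivatives onto `X`.
    have h1 := hN X (N Y Y) X
    have h2 := hN Y (N X Y) X
    rw [h.symm 1 (N Y Y)] at h1
    rw [hsymm] at h2
    linarith

/-- A bi-invariant metric is invariant under the adjoint representation of the Lie algebra. -/
theorem IsBiInvariant.inner_lie [I.Boundaryless] {h : SmoothMetric I G} (hb : IsBiInvariant h)
    (X Y Z : GroupLieAlgebra I G) : h.inner 1 ⁅X, Y⁆ Z = -h.inner 1 Y ⁅X, Z⁆ := by
  have hc := isLeviCivita_leviCivita h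
  -- Torsion-freeness with vanishing bracket exchanges the two fields.
  have hR : ∀ Y : GroupLieAlgebra I G, leviCivita h (rightInvariantVectorField Y) 1 X =
      leviCivita h (mulInvariantVectorField X) 1 Y := by
    intro Y
    have := hc.torsion_free (mdifferentiableAt_mulInvariantVectorField' X 1)
      (mdifferentiableAt_rightInvariantVectorField Y 1)
    rw [mlieBracket_mulInvariantVectorField_rightInvariantVectorField,
      mulInvariantVectorField_one, rightInvariantVectorField_one] at this
    exact sub_eq_zero.1 this
  have hm := hc.metric X (mdifferentiableAt_rightInvariantVectorField Y 1)
    (mdifferentiableAt_rightInvariantVectorField Z 1)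
  simp only [hb.2.inner_rightInvariantVectorField] at hm
  -- Now `hm` is the Killing equation at `1` for the left-invariant field `X`: `⟨∇_Y X, Z⟩ + ⟨Y, ∇_Z
  -- X⟩ = 0`. In the sum of the two Koszul formulas below the `[Y, Z]` terms cancel.
  rw [hR, hR, rightInvariantVectorField_one, rightInvariantVectorField_one] at hm
  have h1 := hc.koszul_mulInvariantVectorField hb.1 1 Y X Z
  have h2 := hc.koszul_mulInvariantVectorField hb.1 1 Z X Y
  rw [mulInvariantVectorField_one, mulInvariantVectorField_one] at h1 h2
  have hswap : ∀ A B : GroupLieAlgebra I G, ⁅A, B⁆ = -⁅B, A⁆ := fun A B ↦ mlieBracket_swap_apply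
  rw [hswap Y X] at h1
  rw [hswap Z X, hswap Z Y] at h2
  rw [h.symm 1 Y ⁅X, Z⁆]
  simp only [map_neg, neg_apply] at h1 h2
  simp only [mvfderiv_const, zero_apply] at hm
  rw [h.symm 1 Y] at hm
  linarith

end LeftInvariantMetric

/-! ### The theorem for paths of metrics. -/

/-- `J` is the parameter interval of the path `h`; all derivatives in `t` are taken within `J`, so
that `0` may be an interior point or an endpoint. -/
theorem lemma1
    {E : Type*} [NormedAddCommGroup E] [NormedSpace ℝ E] [FiniteDimensional ℝ E]
    {H : Type*} [TopologicalSpace H] {I : ModelWithCorners ℝ E H} [I.Boundaryless]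
    {G : Type*} [TopologicalSpace G] [ChartedSpace H G] [Group G] [LieGroup I ∞ G]
    [CompactSpace G]
    (J : Set ℝ) (hJ : J.OrdConnected) (hJ_nontrivial : J.Nontrivial) (hJ_zero : (0 : ℝ) ∈ J)
    (h : ℝ → SmoothMetric I G)
    (h_left : ∀ t ∈ J, IsLeftInvariant (h t))
    (h_zero : IsBiInvariant (h 0))
    (h_smooth : ∀ A B : GroupLieAlgebra I G,
      ContDiffWithinAt ℝ 2 (fun t ↦ (h t).inner 1 A B) J 0)
    (Φ : ℝ → GroupLieAlgebra I G →ₗ[ℝ] GroupLieAlgebra I G)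
    (hΦ : ∀ t ∈ J, ∀ A B : GroupLieAlgebra I G, (h t).inner 1 A B = (h 0).inner 1 (Φ t A) B)
    (Ψ : GroupLieAlgebra I G →ₗ[ℝ] GroupLieAlgebra I G)
    (hΨ : ∀ A : GroupLieAlgebra I G, HasDerivWithinAt (fun t ↦ Φ t A) (Ψ A) J 0)
    (X Y : GroupLieAlgebra I G) (hXY : ⁅X, Y⁆ = 0)
    (k : ℝ → ℝ) (hk : ∀ t ∈ J, k t = lieSectionalCurvature (h t) X Y) :
    ContDiffWithinAt ℝ 2 k J 0 ∧
    k 0 = 0 ∧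
    derivWithin k J 0 = 0 ∧
    2 * iteratedDerivWithin 2 k J 0
      = (h 0).inner 1 (⁅X, Ψ Y⁆ + ⁅Ψ X, Y⁆) (⁅X, Ψ Y⁆ + ⁅Ψ X, Y⁆) ∧
    (∃ D : GroupLieAlgebra I G, HasDerivWithinAt (fun t ↦ ⁅Φ t X, Φ t Y⁆) D J 0 ∧
      2 * iteratedDerivWithin 2 k J 0 = (h 0).inner 1 D D) ∧
    0 ≤ iteratedDerivWithin 2 k J 0 := by
  have := LieGroup.minSmoothness_three (I := I) (G := G)
  have : CompleteSpace E := FiniteDimensional.complete ℝ E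
  have hJu : UniqueDiffOn ℝ J := by
    obtain ⟨a, ha, b, hb, hab⟩ := hJ_nontrivial.exists_lt
    exact uniqueDiffOn_convex hJ.convex
      ⟨(a + b) / 2, mem_interior.2 ⟨Set.Ioo a b, fun x hx ↦ hJ.out ha hb ⟨hx.1.le, hx.2.le⟩,
        isOpen_Ioo, by constructor <;> linarith⟩⟩
  let brL : GroupLieAlgebra I G →ₗ[ℝ] GroupLieAlgebra I G →ₗ[ℝ] GroupLieAlgebra I G :=
    LinearMap.mk₂ ℝ (fun x y ↦ ⁅x, y⁆) add_lie smul_lie lie_add lie_smul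
  -- The Lie algebra is `E` by definition; the bracket is read on the normed space `E`.
  let br : E →ₗ[ℝ] E →ₗ[ℝ] E := brL
  let b : ℝ → E →L[ℝ] E →L[ℝ] ℝ := fun t ↦ (h t).inner 1
  obtain ⟨h1, h2, h3, h4⟩ := second_derivWithin_curvature hJu hJ_zero br
    (lie_self (L := GroupLieAlgebra I G))
    (leibniz_lie (L₁ := GroupLieAlgebra I G) (L₂ := GroupLieAlgebra I G)
      (M := GroupLieAlgebra I G)) b
    (fun v w ↦ (h 0).symm 1 v w) (fun v hv ↦ (h 0).pos 1 v hv)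
    (fun x y z ↦ h_zero.inner_lie x y z) h_smooth Φ hΦ Ψ hΨ X Y hXY k
    (fun t ht ↦ by
      rw [hk t ht]
      exact exists_lieSectionalCurvature_eq (h_left t ht) X Y hXY)
  have h4' : 2 * iteratedDerivWithin 2 k J 0
      = (h 0).inner 1 (⁅X, Ψ Y⁆ + ⁅Ψ X, Y⁆) (⁅X, Ψ Y⁆ + ⁅Ψ X, Y⁆) := h4
  have hΦ0 : ∀ v, Φ 0 v = v := fun v ↦
    (h 0).ext_inner fun w ↦ (hΦ 0 hJ_zero v w).symm
  -- Leibniz rule at `Φ 0 = id`.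
  have hD : HasDerivWithinAt (fun t ↦ br (Φ t X) (Φ t Y)) (br X (Ψ Y) + br (Ψ X) Y) J 0 := by
    let brC : E →L[ℝ] E →L[ℝ] E := LinearMap.toContinuousLinearMap
      ((LinearMap.toContinuousLinearMap : (E →ₗ[ℝ] E) ≃ₗ[ℝ] E →L[ℝ] E).toLinearMap ∘ₗ br)
    have hd : HasDerivWithinAt (fun t ↦ brC (Φ t X) (Φ t Y))
        (brC (Ψ X) (Φ 0 Y) + brC (Φ 0 X) (Ψ Y)) J 0 :=
      (brC.hasFDerivAt.comp_hasDerivWithinAt (0 : ℝ) (hΨ X)).clm_apply (hΨ Y)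
    rw [hΦ0, hΦ0, add_comm] at hd
    exact hd
  refine ⟨h1, h2, h3, h4', ⟨_, hD, h4'⟩, ?_⟩
  have hnonneg : 0 ≤ (h 0).inner 1 (⁅X, Ψ Y⁆ + ⁅Ψ X, Y⁆) (⁅X, Ψ Y⁆ + ⁅Ψ X, Y⁆) := by
    by_cases hv : ⁅X, Ψ Y⁆ + ⁅Ψ X, Y⁆ = 0
    · rw [hv]; simp
    · exact ((h 0).pos 1 _ hv).le
  linarith
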